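/- Let $A$ be an alphabet with exactly two letters and let $W = (W_i)_{i \in \mathbb{N}}$ be an infinite sequence of letters of $A$. A finite word is a subword of $W$ (or of another finite word) if it occurs in it as a block of consecutive letters. Suppose that $W$ is uniformly recurrent, i.e. for every finite subword $u$ of $W$ there is a number $C = C(u, W)$ such that every subword of $W$ of length $C$ contains $u$ as a subword; and suppose that $W$ is not periodic, i.e. $W$ is not of the form $vvv\cdots$ for any nonempty finite word $v$. A finite word $u$ is an obstruction for $W$ if $u$ is not a subword of $W$ but every proper subword of $u$ is a subword of $W$. Let $O_W(n)$ be the number of obstructions for $W$ of length at most $n$. Then $$\limsup_{n \to \infty} \frac{O_W(n)}{\log_3 n} \ge 1,$$ where the upper limit is taken in the extended real line $[-\infty, +\infty]$. -/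

import Mathlib

namespace Cogrowth

variable {α : Type*}

/-- The finite word `u` is a subword (block of consecutive letters) of the infinite
sequence `W`: it is `W i, W (i+1), …, W (i+n-1)` for some `i` and `n`. -/
def IsSubword (W : ℕ → α) (u : List α) : Prop :=
  ∃ i n : ℕ, u = (List.range n).map (fun j => W (i + j))

/-- `W = v v v …` for some nonempty finite word `v`, that is, `W` is invariant under the
shift by some positive integer `p`. -/
def IsPeriodic (W : ℕ → α) : Prop :=
  ∃ p : ℕ, 0 < p ∧ Function.Periodic W p

/-- Every finite subword `u` of `W` has a number `C` such that every subword of `W` of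
length `C` contains `u` (as a block of consecutive letters, `u <:+: v`). -/
def IsUniformlyRecurrent (W : ℕ → α) : Prop :=
  ∀ u : List α, IsSubword W u →
    ∃ C : ℕ, ∀ v : List α, IsSubword W v → v.length = C → u <:+: v

/-- A minimal forbidden word of `W`. -/
def IsObstruction (W : ℕ → α) (u : List α) : Prop :=
  ¬ IsSubword W u ∧ ∀ v : List α, v <:+: u → v ≠ u → IsSubword W v

/-- The number of obstructions of `W` of length at most `n`. -/
noncomputable def cogrowth (W : ℕ → α) (n : ℕ) : ℕ :=
  {u : List α | IsObstruction W u ∧ u.length ≤ n}.ncard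

/-- Over a finite alphabet the set counted by `cogrowth` is finite. -/
theorem finite_obstructions [Finite α] (W : ℕ → α) (n : ℕ) :
    {u : List α | IsObstruction W u ∧ u.length ≤ n}.Finite :=
  (List.finite_length_le α n).subset fun _ h => h.2

end Cogrowth

/-! If the upper limit were below 1, then `3 ^ cogrowth W n ≤ n` for all large `n`. Fix such an `n =
N + 1` and a subword `v` of length `n + 1`. A subword of `W` of any prescribed length that avoids
`v` would contradict uniform recurrence.

Such a subword is built among the words whose blocks of length at most `n` lie in `W`. By
`hasGap_two_pow_cogrowth`, right special blocks of length `N` recur with gaps at most `E = 2 ^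
cogrowth W n`, so each such word has two different extensions by `E` letters
(`exists_two_extensions`). It remains to avoid `v` and the obstructions longer than `n`. Since `8 ≤
9`, `E ^ 3 ≤ n ^ 2`, so these forbidden words are long compared with `E`, and by assumption they are
few. An inductive count (`exists_avoiding_word`) then shows that the words avoiding them multiply by
at least `3 / 2` at each step. A survivor contains no obstruction at all, hence is a subword of `W`.
-/

namespace Cogrowth

variable {α : Type*}

/-! ### Blocks, recurrence and eventual periods -/

/-- The block of length `n` of `W` that starts at position `i`. -/
def block (W : ℕ → α) (i n : ℕ) : List α :=
  (List.range n).map fun j => W (i + j)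

@[simp]
theorem length_block (W : ℕ → α) (i n : ℕ) : (block W i n).length = n := by
  simp [block]

theorem block_add (W : ℕ → α) (i m n : ℕ) :
    block W i (m + n) = block W i m ++ block W (i + m) n := by
  simp [block, List.range_add, add_assoc, Function.comp_def]

theorem block_succ (W : ℕ → α) (i n : ℕ) :
    block W i (n + 1) = block W i n ++ [W (i + n)] := by
  rw [block_add]; simp [block]

theorem block_succ' (W : ℕ → α) (i n : ℕ) :
    block W i (n + 1) = W i :: block W (i + 1) n := by
  rw [add_comm n, block_add]; simp [block]

theorem isSubword_block (W : ℕ → α) (i n : ℕ) : IsSubword W (block W i n) := ⟨i, n, rfl⟩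

theorem IsSubword.exists_block {W : ℕ → α} {u : List α} (h : IsSubword W u) :
    ∃ i, u = block W i u.length := by
  obtain ⟨i, n, rfl⟩ := h
  exact ⟨i, by simp [block]⟩

theorem IsSubword.of_append {W : ℕ → α} {p u q : List α} (h : IsSubword W (p ++ u ++ q)) :
    IsSubword W u := by
  obtain ⟨i, hi⟩ := h.exists_block
  rw [List.length_append, List.length_append, block_add, block_add] at hi
  have h1 := List.append_inj' hi (by simp)
  have h2 := List.append_inj' h1.1 (by simp)
  rw [h2.2]
  exact isSubword_block ..

theorem IsSubword.of_infix {W : ℕ → α} {u v : List α} (h : IsSubword W v) (huv : u <:+: v) :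
    IsSubword W u := by
  obtain ⟨p, q, rfl⟩ := huv
  exact h.of_append

/-- A word with no obstruction among its blocks is a subword. -/
theorem isSubword_of_forall_not_isObstruction {W : ℕ → α} {w : List α}
    (h : ∀ u, u <:+: w → ¬ IsObstruction W u) : IsSubword W w := by
  induction hn : w.length using Nat.strong_induction_on generalizing w with
  | _ n ih =>
    subst hn
    by_contra hw
    refine h w (List.infix_refl w) ⟨hw, fun v hv hne => ih v.length ?_ (w := v) ?_ rfl⟩
    · exact lt_of_le_of_ne hv.length_le fun he => hne (hv.eq_of_length he)
    · exact fun u hu => h u (hu.trans hv)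

/-- Every subword of a uniformly recurrent sequence occurs arbitrarily far out. -/
theorem IsUniformlyRecurrent.exists_block_eq {W : ℕ → α} (hW : IsUniformlyRecurrent W)
    {u : List α} (hu : IsSubword W u) (N : ℕ) : ∃ i, N ≤ i ∧ block W i u.length = u := by
  obtain ⟨C, hC⟩ := hW u hu
  obtain ⟨p, q, hpq⟩ := hC (block W N C) (isSubword_block ..) (by simp)
  have hl : C = p.length + u.length + q.length := by
    have := congrArg List.length hpq
    simpa [add_assoc] using this.symm
  rw [hl, block_add, block_add] at hpq
  have h1 := List.append_inj' hpq (by simp)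
  have h2 := List.append_inj' h1.1 (by simp)
  exact ⟨N + p.length, by omega, h2.2.symm⟩

/-- The block of length `T + 1` at any `m` reappears beyond `p`, where its first and last letters
agree. -/
theorem IsUniformlyRecurrent.isPeriodic_of_eventually {W : ℕ → α} (hW : IsUniformlyRecurrent W)
    {p T : ℕ} (hT : 0 < T) (h : ∀ m, p ≤ m → W (m + T) = W m) : IsPeriodic W := by
  refine ⟨T, hT, fun m => ?_⟩
  obtain ⟨i, hi, he⟩ := hW.exists_block_eq (isSubword_block W m (T + 1)) p
  rw [length_block] at he
  have h1 := he
  rw [block_succ, block_succ] at h1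
  rw [block_succ', block_succ'] at he
  have h2 := (List.append_inj' h1 rfl).2
  simp only [List.cons.injEq, and_true] at h2 he
  rw [← h2, ← he.1, h i hi]

/-! ### Right special blocks and their gaps -/

/-- Every one-letter extension of `w` to the right is a subword. -/
def IsRightSpecial (W : ℕ → α) (w : List α) : Prop := ∀ a, IsSubword W (w ++ [a])

theorem eq_of_not_isRightSpecial (hα : Nat.card α = 2) {W : ℕ → α} {w : List α}
    (hw : ¬ IsRightSpecial W w) {a b : α} (ha : IsSubword W (w ++ [a]))
    (hb : IsSubword W (w ++ [b])) : a = b := by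
  by_contra hab
  refine hw fun c => ?_
  obtain ⟨x, y, hxy, huniv⟩ := Nat.card_eq_two_iff.1 hα
  have hc : ∀ z : α, z = x ∨ z = y := fun z => by
    have : z ∈ ({x, y} : Set α) := huniv ▸ Set.mem_univ z
    simpa using this
  have : c = a ∨ c = b := by
    rcases hc a with rfl | rfl <;> rcases hc b with rfl | rfl <;> rcases hc c with rfl | rfl <;>
      simp_all
  rcases this with rfl | rfl <;> assumption

/-- A return to the same block without meeting a right special block forces periodicity. -/
theorem IsUniformlyRecurrent.isPeriodic_of_block_eq (hα : Nat.card α = 2) {W : ℕ → α}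
    (hW : IsUniformlyRecurrent W) {p T n : ℕ} (hT : 0 < T)
    (heq : block W p n = block W (p + T) n)
    (hns : ∀ q < T, ¬ IsRightSpecial W (block W (p + q) n)) : IsPeriodic W := by
  have key : ∀ q, block W (p + q) n = block W (p + q + T) n ∧
      ¬ IsRightSpecial W (block W (p + q) n) := by
    intro q
    induction q using Nat.strong_induction_on with
    | _ q ih =>
      have h1 : block W (p + q) n = block W (p + q + T) n := by
        rcases q with _ | q
        · simpa using heq
        · obtain ⟨he, hs⟩ := ih q (by omega)
          have hlast : W (p + q + n) = W (p + q + T + n) := by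
            refine eq_of_not_isRightSpecial hα hs ?_ ?_
            · rw [← block_succ]; exact isSubword_block ..
            · rw [he, ← block_succ]; exact isSubword_block ..
          have h2 : block W (p + q) (n + 1) = block W (p + q + T) (n + 1) := by
            rw [block_succ, block_succ, he, hlast]
          rw [block_succ', block_succ'] at h2
          have h3 := (List.cons.inj h2).2
          rw [show p + (q + 1) = p + q + 1 by ring, h3]
          congr 1
          ring
      refine ⟨h1, ?_⟩
      by_cases hq : q < T
      · exact hns q hq
      · obtain ⟨he, hs⟩ := ih (q - T) (by omega)
        rwa [he, show p + (q - T) + T = p + q by omega] at hs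
  refine hW.isPeriodic_of_eventually (p := p + n) hT fun m hm => ?_
  obtain ⟨q, rfl⟩ := Nat.exists_eq_add_of_le hm
  obtain ⟨he, hs⟩ := key q
  refine (eq_of_not_isRightSpecial hα hs (a := W (p + n + q)) ?_ ?_).symm
  · rw [show p + n + q = p + q + n by ring, ← block_succ]; exact isSubword_block ..
  · rw [he, show p + n + q + T = p + q + T + n by ring, ← block_succ]; exact isSubword_block ..

/-- Among any `E` consecutive blocks of length `n` there is a right special one. -/
def HasGap (W : ℕ → α) (n E : ℕ) : Prop :=
  ∀ i, ∃ j, i ≤ j ∧ j < i + E ∧ IsRightSpecial W (block W j n)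

theorem hasGap_zero (hα : Nat.card α = 2) {W : ℕ → α} (hper : ¬ IsPeriodic W) :
    HasGap W 0 1 := by
  have h0 : IsRightSpecial W [] := by
    by_contra h
    refine hper ⟨1, one_pos, fun m => ?_⟩
    refine eq_of_not_isRightSpecial hα h ?_ ?_
    · simpa [block] using isSubword_block W (m + 1) 1
    · simpa [block] using isSubword_block W m 1
  exact fun i => ⟨i, le_rfl, by omega, by simpa [block] using h0⟩

theorem HasGap.mono {W : ℕ → α} {n E E' : ℕ} (h : HasGap W n E) (hE : E ≤ E') :
    HasGap W n E' := fun i => by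
  obtain ⟨j, h1, h2, h3⟩ := h i
  exact ⟨j, h1, by omega, h3⟩

theorem isObstruction_of_isRightSpecial {W : ℕ → α} {i n : ℕ} {y : α}
    (h : IsRightSpecial W (block W (i + 1) n)) (hy : ¬ IsSubword W (block W i (n + 1) ++ [y])) :
    IsObstruction W (block W i (n + 1) ++ [y]) := by
  refine ⟨hy, fun v hv hne => ?_⟩
  rcases List.infix_concat_iff.1 hv with hv | hv
  · rcases List.suffix_cons_iff (a := W i) (l₁ := v) (l₂ := block W (i + 1) n ++ [y]) |>.1
      (by simpa [block_succ'] using hv) with rfl | hv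
    · exact absurd (by simp [block_succ']) hne
    · exact (h y).of_infix hv.isInfix
  · exact (isSubword_block W i (n + 1)).of_infix hv

/-- Extend a right special block of length `n` one letter to the left. If the result is not right
special, the letter that cannot follow it completes an obstruction of length `n + 2`. With one more
window than such obstructions, one of them repeats, and a return free of right special blocks forces
periodicity. -/
theorem HasGap.succ (hα : Nat.card α = 2) {W : ℕ → α} (hW : IsUniformlyRecurrent W)
    (hper : ¬ IsPeriodic W) {n E : ℕ} (h : HasGap W n E) :
    HasGap W (n + 1) (({u : List α | IsObstruction W u ∧ u.length = n + 2}.ncard + 1) * E) := by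
  intro i
  by_contra! hcon
  have : Finite α := Nat.finite_of_card_ne_zero (by omega)
  set D := {u : List α | IsObstruction W u ∧ u.length = n + 2} with hD
  have hfin : D.Finite := (List.finite_length_eq α (n + 2)).subset fun _ hu => hu.2
  have hstep : ∀ k < D.ncard + 1, ∃ p y, i + k * E ≤ p ∧ p < i + (k + 1) * E ∧
      block W p (n + 1) ++ [y] ∈ D := by
    intro k hk
    -- The shift by 1 keeps the left extension, at `j - 1`, inside the `k`-th window.
    obtain ⟨j, hj1, hj2, hj3⟩ := h (i + k * E + 1)
    obtain ⟨p, rfl⟩ : ∃ p, j = p + 1 := ⟨j - 1, by omega⟩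
    have hle : (k + 1) * E ≤ (D.ncard + 1) * E := Nat.mul_le_mul_right _ hk
    have hp : p < i + (k + 1) * E := by rw [add_mul]; omega
    have hs := hcon p (by omega) (by omega)
    simp only [IsRightSpecial, not_forall] at hs
    obtain ⟨y, hy⟩ := hs
    exact ⟨p, y, by omega, hp, isObstruction_of_isRightSpecial hj3 hy, by simp⟩
  have : Nonempty α := ⟨W 0⟩
  choose! p y hp1 hp2 hp3 using hstep
  obtain ⟨k, hk, l, hl, hkl, he⟩ := Finset.exists_ne_map_eq_of_card_lt_of_maps_to
    (s := Finset.range (D.ncard + 1)) (t := hfin.toFinset)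
    (f := fun k => block W (p k) (n + 1) ++ [y k])
    (by rw [Finset.card_range, ← Set.ncard_eq_toFinset_card D hfin]; omega)
    (fun k hk => by simpa using hp3 k (by simpa using hk))
  wlog hlt : k < l generalizing k l
  · exact this l hl k hk hkl.symm he.symm (by omega)
  have he' : block W (p k) (n + 1) = block W (p l) (n + 1) := (List.append_inj' he rfl).1
  rw [Finset.mem_range] at hk hl
  have h1 := hp2 k hk
  have h2 := hp1 l hl
  have h3 : (k + 1) * E ≤ l * E := Nat.mul_le_mul_right _ hlt
  have h4 := hp1 k hk
  have h5 := hp2 l hl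
  have h6 : (l + 1) * E ≤ (D.ncard + 1) * E := Nat.mul_le_mul_right _ hl
  refine hper (hW.isPeriodic_of_block_eq hα (p := p k) (T := p l - p k) (n := n + 1) (by omega)
    ?_ fun q hq => hcon _ (by omega) (by omega))
  rw [he', show p k + (p l - p k) = p l by omega]

theorem cogrowth_succ [Finite α] (W : ℕ → α) (n : ℕ) :
    cogrowth W (n + 1) =
      cogrowth W n + {u : List α | IsObstruction W u ∧ u.length = n + 1}.ncard := by
  unfold cogrowth
  rw [← Set.ncard_union_eq _ (finite_obstructions W n)
    ((finite_obstructions W (n + 1)).subset fun u hu => ⟨hu.1, hu.2.le⟩)]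
  · congr 1
    ext u
    simp only [Set.mem_ofPred_eq, Set.mem_union, Nat.le_succ_iff]
    tauto
  · rw [Set.disjoint_left]
    rintro u ⟨_, h1⟩ ⟨_, h2⟩
    omega

theorem hasGap_two_pow_cogrowth (hα : Nat.card α = 2) {W : ℕ → α} (hW : IsUniformlyRecurrent W)
    (hper : ¬ IsPeriodic W) (n : ℕ) : HasGap W n (2 ^ cogrowth W (n + 1)) := by
  have : Finite α := Nat.finite_of_card_ne_zero (by omega)
  induction n with
  | zero => exact (hasGap_zero hα hper).mono Nat.one_le_two_pow
  | succ n ih =>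
    refine (ih.succ hα hW hper).mono ?_
    rw [cogrowth_succ W (n + 1), pow_add, mul_comm]
    exact Nat.mul_le_mul_left _ Nat.lt_two_pow_self

/-! ### Extending locally admissible words -/

/-- All blocks of `w` of length at most `n` are subwords of `W`. -/
def IsLocalSubword (W : ℕ → α) (n : ℕ) (w : List α) : Prop :=
  ∀ u, u <:+: w → u.length ≤ n → IsSubword W u

theorem IsLocalSubword.concat {W : ℕ → α} {N : ℕ} {w s : List α} {y : α}
    (hw : IsLocalSubword W (N + 1) w) (hs : s <:+ w) (hN : N ≤ s.length ∨ s = w)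
    (hy : IsSubword W (s ++ [y])) : IsLocalSubword W (N + 1) (w ++ [y]) := by
  intro u hu hlen
  rcases List.infix_concat_iff.1 hu with hu | hu
  · refine hy.of_infix (List.suffix_of_suffix_length_le hu ?_ ?_).isInfix
    · obtain ⟨t, rfl⟩ := hs
      exact ⟨t, by simp⟩
    · rcases hN with hN | rfl
      · simp; omega
      · exact hu.length_le
  · exact hw u hu hlen

theorem IsLocalSubword.append_block {W : ℕ → α} {N i l : ℕ} {w : List α}
    (hw : IsLocalSubword W (N + 1) w) (hs : block W i l <:+ w) (hN : N ≤ l ∨ block W i l = w)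
    (r : ℕ) : IsLocalSubword W (N + 1) (w ++ block W (i + l) r) := by
  induction r with
  | zero => simpa [block] using hw
  | succ r ih =>
    rw [block_succ, ← List.append_assoc]
    refine ih.concat (s := block W i (l + r)) ?_ ?_ ?_
    · obtain ⟨t, rfl⟩ := hs
      exact ⟨t, by simp [block_add]⟩
    · rcases hN with hN | rfl
      · left; simp; omega
      · right; rw [block_add]
    · rw [add_assoc i, ← block_succ]
      exact isSubword_block ..

theorem IsLocalSubword.exists_suffix_block {W : ℕ → α} (hW : IsUniformlyRecurrent W) {N : ℕ}
    {w : List α} (hw : IsLocalSubword W (N + 1) w) :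
    ∃ i l, N ≤ i ∧ block W i l <:+ w ∧ (N = l ∨ l < N ∧ block W i l = w) := by
  have hsuf : w.drop (w.length - N) <:+ w := List.drop_suffix ..
  obtain ⟨i, hi, he⟩ := hW.exists_block_eq (hw _ hsuf.isInfix (by simp; omega)) N
  refine ⟨i, _, hi, he ▸ hsuf, ?_⟩
  rw [he]
  by_cases h : N ≤ w.length
  · left; simp; omega
  · right
    rw [show w.length - N = 0 by omega]
    simp; omega

theorem IsLocalSubword.exists_append {W : ℕ → α} (hW : IsUniformlyRecurrent W) {N : ℕ}
    {w : List α} (hw : IsLocalSubword W (N + 1) w) (r : ℕ) :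
    ∃ x : List α, x.length = r ∧ IsLocalSubword W (N + 1) (w ++ x) := by
  obtain ⟨i, l, -, hs, hN⟩ := hw.exists_suffix_block hW
  exact ⟨_, length_block _ _ _, hw.append_block hs (hN.imp (fun h => h.le) (fun h => h.2)) r⟩

/-- Following an occurrence of the end of `w` up to a right special block. -/
theorem IsLocalSubword.exists_branch {W : ℕ → α} (hW : IsUniformlyRecurrent W) {N E : ℕ}
    (hgap : HasGap W N E) {w : List α} (hw : IsLocalSubword W (N + 1) w) :
    ∃ t : List α, t.length < E ∧ ∀ y, IsLocalSubword W (N + 1) (w ++ t ++ [y]) := by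
  obtain ⟨i, l, hi, hs, hN⟩ := hw.exists_suffix_block hW
  -- The search starts at the block of length `N` ending where `w` ends; `N ≤ i` prevents
  -- truncation.
  obtain ⟨j, hj1, hj2, hj3⟩ := hgap (i + l - N)
  have hl : l ≤ N := by rcases hN with h | h <;> omega
  have hr := hw.append_block hs (hN.imp (fun h => h.le) (fun h => h.2)) (j + N - (i + l))
  refine ⟨block W (i + l) (j + N - (i + l)), by rw [length_block]; omega, fun y => ?_⟩
  have hsuf : block W i (j + N - i) <:+ w ++ block W (i + l) (j + N - (i + l)) := by
    obtain ⟨t, rfl⟩ := hs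
    refine ⟨t, ?_⟩
    rw [show j + N - i = l + (j + N - (i + l)) by omega, block_add, List.append_assoc]
  by_cases hij : i ≤ j
  · refine hr.concat (s := block W j N) ?_ (by simp) (hj3 y)
    refine List.IsSuffix.trans ⟨block W i (j - i), ?_⟩ hsuf
    rw [show j + N - i = (j - i) + N by omega, block_add, show i + (j - i) = j by omega]
  -- Now the whole extended word is shorter than `N` and is a suffix of the right special block.
  · rcases hN with hN | ⟨hN, rfl⟩
    · omega
    · refine hr.concat (List.suffix_refl _) (Or.inr rfl) ((hj3 y).of_infix ?_)
      refine List.IsSuffix.isInfix ⟨block W j (i - j), ?_⟩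
      rw [← block_add, ← List.append_assoc]
      congr 1
      rw [show N = (i - j) + (l + (j + N - (i + l))) by omega, block_add W j,
        show j + (i - j) = i by omega]
      congr 2
      omega

theorem IsLocalSubword.exists_two_extensions (hα : Nat.card α = 2) {W : ℕ → α}
    (hW : IsUniformlyRecurrent W) {N E : ℕ} (hgap : HasGap W N E) {w : List α}
    (hw : IsLocalSubword W (N + 1) w) :
    ∃ x : Bool → List α, x.Injective ∧
      ∀ b, (x b).length = E ∧ IsLocalSubword W (N + 1) (w ++ x b) := by
  obtain ⟨y, y', hy, -⟩ := Nat.card_eq_two_iff.1 hα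
  obtain ⟨t, ht, hbr⟩ := hw.exists_branch hW hgap
  have hz := fun a => (hbr a).exists_append hW (E - t.length - 1)
  choose z hz1 hz2 using hz
  refine ⟨fun b => t ++ [bif b then y else y'] ++ z (bif b then y else y'), ?_, fun b => ⟨?_, ?_⟩⟩
  · rintro (_ | _) (_ | _) h
    · rfl
    · have := List.append_inj' (List.append_inj' h (by simp [hz1])).1 rfl
      simp [hy.symm] at this
    · have := List.append_inj' (List.append_inj' h (by simp [hz1])).1 rfl
      simp [hy] at this
    · rfl
  · simp [hz1]; omega
  · simpa using hz2 (bif b then y else y')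

/-! ### Counting words that avoid long forbidden words -/

open Classical in
/-- The words obtained from the empty one by `m` steps, each of which appends one of the two
extensions of the current word and keeps the results that avoid all `F k`. -/
noncomputable def avoidingWords (ext : List α → Bool → List α) (F : ℕ → Finset (List α)) :
    ℕ → Finset (List α)
  | 0 => {[]}
  | m + 1 => (((avoidingWords ext F m) ×ˢ (Finset.univ : Finset Bool)).filter
      fun p => ∀ k, ∀ f ∈ F k, ¬ f <:+: p.1 ++ ext p.1 p.2).image fun p => p.1 ++ ext p.1 p.2

theorem mem_avoidingWords_succ {ext : List α → Bool → List α} {F : ℕ → Finset (List α)} {m : ℕ}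
    {x : List α} : x ∈ avoidingWords ext F (m + 1) ↔
      ∃ w ∈ avoidingWords ext F m, ∃ b, (∀ k, ∀ f ∈ F k, ¬ f <:+: w ++ ext w b) ∧
        w ++ ext w b = x := by
  simp [avoidingWords, and_assoc]

section

variable {G : List α → Prop} {E : ℕ} {ext : List α → Bool → List α} {F : ℕ → Finset (List α)}

theorem avoidingWords_spec (h0 : G [])
    (hext : ∀ w, G w → ∀ b, (ext w b).length = E ∧ G (w ++ ext w b))
    {m : ℕ} {w : List α} (hw : w ∈ avoidingWords ext F m) : G w ∧ w.length = m * E := by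
  induction m generalizing w with
  | zero =>
    simp only [avoidingWords, Finset.mem_singleton] at hw
    subst hw
    simpa using h0
  | succ m ih =>
    obtain ⟨v, hv, b, -, rfl⟩ := mem_avoidingWords_succ.1 hw
    obtain ⟨h1, h2⟩ := ih hv
    exact ⟨(hext v h1 b).2, by simp [h2, (hext v h1 b).1, add_mul]⟩

theorem take_mem_avoidingWords (h0 : G [])
    (hext : ∀ w, G w → ∀ b, (ext w b).length = E ∧ G (w ++ ext w b))
    {m j : ℕ} (hj : j ≤ m) {w : List α} (hw : w ∈ avoidingWords ext F m) :
    w.take (j * E) ∈ avoidingWords ext F j := by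
  induction m, hj using Nat.le_induction generalizing w with
  | base => rwa [List.take_of_length_le (avoidingWords_spec h0 hext hw).2.le]
  | succ m hm ih =>
    obtain ⟨v, hv, b, -, rfl⟩ := mem_avoidingWords_succ.1 hw
    rw [List.take_append_of_le_length]
    · exact ih hv
    · rw [(avoidingWords_spec h0 hext hv).2]
      exact Nat.mul_le_mul_right _ hm

theorem not_infix_of_mem_avoidingWords (hE : 0 < E)
    (hF : ∀ k, ∀ f ∈ F k, (k + 1) * E ≤ f.length) {m : ℕ} {w : List α}
    (hw : w ∈ avoidingWords ext F m) {k : ℕ} {f : List α} (hf : f ∈ F k) : ¬ f <:+: w := by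
  cases m with
  | zero =>
    simp only [avoidingWords, Finset.mem_singleton] at hw
    subst hw
    intro h
    have h1 := hF k f hf
    have h2 := h.length_le
    simp only [List.length_nil] at h2
    have : 0 < (k + 1) * E := by positivity
    omega
  | succ m =>
    obtain ⟨v, hv, b, h, rfl⟩ := mem_avoidingWords_succ.1 hw
    exact h k f hf

/-- Extensions of words of level `m` in which `f` occurs `r` letters before the end are
determined by a prefix of level `m - k`. -/
theorem card_filter_occurrence_le (h0 : G [])
    (hext : ∀ w, G w → ∀ b, (ext w b).length = E ∧ G (w ++ ext w b))
    {k : ℕ} {f : List α} (hf : (k + 1) * E ≤ f.length) (m : ℕ) {r : ℕ} (hr : r < E)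
    [DecidablePred fun p : List α × Bool =>
        ∃ u v, u ++ f ++ v = p.1 ++ ext p.1 p.2 ∧ v.length = r] :
    ((avoidingWords ext F m ×ˢ (Finset.univ : Finset Bool)).filter fun p =>
        ∃ u v, u ++ f ++ v = p.1 ++ ext p.1 p.2 ∧ v.length = r).card
      ≤ 2 * (avoidingWords ext F (m - k)).card := by
  rw [show 2 * (avoidingWords ext F (m - k)).card =
      (avoidingWords ext F (m - k) ×ˢ (Finset.univ : Finset Bool)).card by
    simp [Finset.card_product, mul_comm]]
  refine Finset.card_le_card_of_injOn (fun p => (p.1.take ((m - k) * E), p.2)) ?_ ?_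
  · rintro ⟨w, b⟩ hp
    simp only [Finset.coe_filter, Finset.mem_product, Finset.mem_univ, and_true,
      Set.mem_ofPred_eq] at hp
    simpa using take_mem_avoidingWords h0 hext (Nat.sub_le m k) hp.1
  · rintro ⟨w, b⟩ hp ⟨w', b'⟩ hp' heq
    simp only [Finset.coe_filter, Finset.mem_product, Finset.mem_univ, and_true,
      Set.mem_ofPred_eq] at hp hp'
    obtain ⟨hw, u, v, huv, hv⟩ := hp
    obtain ⟨hw', u', v', huv', hv'⟩ := hp'
    simp only [Prod.mk.injEq] at heq ⊢
    refine ⟨?_, heq.2⟩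
    obtain ⟨hG, hl⟩ := avoidingWords_spec h0 hext hw
    obtain ⟨hG', hl'⟩ := avoidingWords_spec h0 hext hw'
    have hlen := congrArg List.length huv
    have hlen' := congrArg List.length huv'
    simp only [List.length_append, (hext w hG b).1, (hext w' hG' b').1] at hlen hlen'
    have hm : m * E ≤ (m - k) * E + k * E := by
      rw [← add_mul]; exact Nat.mul_le_mul_right _ (by omega)
    have hmk : (m - k) * E ≤ m * E := Nat.mul_le_mul_right _ (by omega)
    rw [add_mul, one_mul] at hf
    -- So `u` lies in the prefix of level `m - k`, while `u ++ f` covers level `m` because `r < E`.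
    have hu : u.length ≤ (m - k) * E := by omega
    have hpre : ∀ {w u v : List α} {b : Bool}, u ++ f ++ v = w ++ ext w b → w.length = m * E →
        u.length ≤ (m - k) * E → u = (w.take ((m - k) * E)).take u.length := by
      intro w u v b h hw hu
      have := congrArg (List.take u.length) h
      rw [List.append_assoc, List.take_left, List.take_append_of_le_length (by omega)] at this
      rw [List.take_take, min_eq_left hu, ← this]
    have huu : u = u' := by
      rw [hpre huv hl hu, hpre huv' hl' (by omega), heq.1, show u.length = u'.length by omega]
    subst huu
    have hw1 := congrArg (List.take (m * E)) huv
    have hw2 := congrArg (List.take (m * E)) huv'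
    rw [List.take_append_of_le_length (by simp; omega), ← hl, List.take_left] at hw1
    rw [List.take_append_of_le_length (by simp; omega), ← hl', List.take_left] at hw2
    rw [← hw1, ← hw2, hl, hl']

-- A rejected extension contains some `f` that the word of level `m` avoided, so `f` ends within the
-- last `E` letters: at most `E` positions for each `f`.
open Classical in
theorem two_mul_card_avoidingWords_le (hE : 0 < E) (h0 : G [])
    (hext : ∀ w, G w → ∀ b, (ext w b).length = E ∧ G (w ++ ext w b))
    (hinj : ∀ w, G w → (ext w).Injective)
    (hF : ∀ k, ∀ f ∈ F k, (k + 1) * E ≤ f.length) (m : ℕ) :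
    2 * (avoidingWords ext F m).card ≤ (avoidingWords ext F (m + 1)).card +
      ∑ k ∈ Finset.range (m + 1), (F k).card * (E * (2 * (avoidingWords ext F (m - k)).card)) := by
  set P := avoidingWords ext F m ×ˢ (Finset.univ : Finset Bool) with hP
  have hcardP : P.card = 2 * (avoidingWords ext F m).card := by
    simp [hP, Finset.card_product, mul_comm]
  have hgood : (avoidingWords ext F (m + 1)).card =
      (P.filter fun p => ∀ k, ∀ f ∈ F k, ¬ f <:+: p.1 ++ ext p.1 p.2).card := by
    rw [avoidingWords, Finset.card_image_of_injOn]
    rintro ⟨w, b⟩ hp ⟨w', b'⟩ hp' heq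
    simp only [Finset.coe_filter, Finset.mem_product, Finset.mem_univ, and_true,
      Set.mem_ofPred_eq] at hp hp'
    have h1 := avoidingWords_spec h0 hext hp.1
    have h2 := avoidingWords_spec h0 hext hp'.1
    change w ++ ext w b = w' ++ ext w' b' at heq
    obtain ⟨rfl, h3⟩ := List.append_inj heq (h1.2.trans h2.2.symm)
    exact congrArg (Prod.mk w) (hinj w h1.1 h3)
  have hbad : P.filter (fun p => ¬ ∀ k, ∀ f ∈ F k, ¬ f <:+: p.1 ++ ext p.1 p.2) ⊆
      (Finset.range (m + 1)).biUnion fun k => (F k).biUnion fun f =>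
        (Finset.range E).biUnion fun r => P.filter fun p =>
          ∃ u v, u ++ f ++ v = p.1 ++ ext p.1 p.2 ∧ v.length = r := by
    rintro ⟨w, b⟩ hp
    obtain ⟨hmem, hp⟩ := Finset.mem_filter.1 hp
    push Not at hp
    obtain ⟨k, f, hf, u, v, huv⟩ := hp
    have hw := (Finset.mem_product.1 hmem).1
    obtain ⟨hG, hl⟩ := avoidingWords_spec h0 hext hw
    have hlen := congrArg List.length huv
    simp only [List.length_append, (hext w hG b).1, hl] at hlen
    have hk : (k + 1) * E ≤ (m + 1) * E := by
      have := hF k f hf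
      rw [add_mul m]; omega
    have hk' : k + 1 ≤ m + 1 := Nat.le_of_mul_le_mul_right hk hE
    have hv : v.length < E := by
      by_contra hv
      refine not_infix_of_mem_avoidingWords hE hF hw hf (List.IsInfix.trans (l₂ := u ++ f)
        (List.suffix_append u f).isInfix (List.IsPrefix.isInfix ?_))
      refine List.prefix_of_prefix_length_le ⟨v, huv⟩ (List.prefix_append w (ext w b)) ?_
      simp only [List.length_append, hl]
      omega
    simp only [Finset.mem_biUnion, Finset.mem_range, Finset.mem_filter]
    exact ⟨k, hk', f, hf, v.length, hv, hmem, u, v, huv, rfl⟩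
  rw [← hcardP, hgood, ← Finset.card_filter_add_card_filter_not (s := P)
    fun p => ∀ k, ∀ f ∈ F k, ¬ f <:+: p.1 ++ ext p.1 p.2]
  gcongr
  refine (Finset.card_le_card hbad).trans (Finset.card_biUnion_le.trans ?_)
  refine Finset.sum_le_sum fun k _ => ?_
  refine Finset.card_biUnion_le_card_mul _ _ _ fun f hf => ?_
  refine (Finset.card_biUnion_le_card_mul _ _ _ fun r hr => ?_).trans (by rw [Finset.card_range])
  exact card_filter_occurrence_le h0 hext (hF k f hf) m (Finset.mem_range.1 hr)

/-- Growth at earlier levels bounds level `m - k` by `(2 / 3) ^ k` times level `m`, so rejections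
cost at most `1 / 2` of the factor 2. -/
theorem card_avoidingWords_growth (hE : 0 < E) (h0 : G [])
    (hext : ∀ w, G w → ∀ b, (ext w b).length = E ∧ G (w ++ ext w b))
    (hinj : ∀ w, G w → (ext w).Injective)
    (hF : ∀ k, ∀ f ∈ F k, (k + 1) * E ≤ f.length)
    (hsum : ∀ m, ∑ k ∈ Finset.range m, ((F k).card * E * 2 : ℝ) * (2 / 3) ^ k ≤ 1 / 2) (m : ℕ) :
    3 / 2 * ((avoidingWords ext F m).card : ℝ) ≤ (avoidingWords ext F (m + 1)).card := by
  induction m using Nat.strong_induction_on with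
  | _ m ih =>
    have hdecay : ∀ k ≤ m, ((avoidingWords ext F (m - k)).card : ℝ) ≤
        (2 / 3) ^ k * (avoidingWords ext F m).card := by
      intro k hk
      induction k with
      | zero => simp
      | succ k ihk =>
        have h1 := ih (m - (k + 1)) (by omega)
        rw [show m - (k + 1) + 1 = m - k by omega] at h1
        have h2 := ihk (by omega)
        rw [pow_succ]
        linarith
    have hmain : (2 * (avoidingWords ext F m).card : ℝ) ≤ (avoidingWords ext F (m + 1)).card +
        ∑ k ∈ Finset.range (m + 1),
          ((F k).card * (E * (2 * (avoidingWords ext F (m - k)).card)) : ℝ) := by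
      exact_mod_cast two_mul_card_avoidingWords_le hE h0 hext hinj hF m
    have hle : ∑ k ∈ Finset.range (m + 1),
          ((F k).card * (E * (2 * (avoidingWords ext F (m - k)).card)) : ℝ) ≤
        (∑ k ∈ Finset.range (m + 1), ((F k).card * E * 2 : ℝ) * (2 / 3) ^ k) *
          (avoidingWords ext F m).card := by
      rw [Finset.sum_mul]
      refine Finset.sum_le_sum fun k hk => ?_
      have := hdecay k (by simpa [Nat.lt_succ_iff] using hk)
      calc ((F k).card * (E * (2 * (avoidingWords ext F (m - k)).card)) : ℝ)
          = (F k).card * E * 2 * (avoidingWords ext F (m - k)).card := by ring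
        _ ≤ (F k).card * E * 2 * ((2 / 3) ^ k * (avoidingWords ext F m).card) := by gcongr
        _ = _ := by ring
    have := mul_le_mul_of_nonneg_right (hsum (m + 1))
      (Nat.cast_nonneg (α := ℝ) (avoidingWords ext F m).card)
    linarith

end

/-- If every word of `G` has two extensions in `G` by `E` letters and the forbidden words `F k`,
of length at least `(k + 1) * E`, are few, then `G` has arbitrarily long words that avoid them. -/
theorem exists_avoiding_word {G : List α → Prop} {E : ℕ} (hE : 0 < E) (h0 : G [])
    (hext : ∀ w, G w → ∃ x : Bool → List α, x.Injective ∧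
      ∀ b, (x b).length = E ∧ G (w ++ x b))
    {F : ℕ → Finset (List α)} (hF : ∀ k, ∀ f ∈ F k, (k + 1) * E ≤ f.length)
    (hsum : ∀ m, ∑ k ∈ Finset.range m, ((F k).card * E * 2 : ℝ) * (2 / 3) ^ k ≤ 1 / 2) (m : ℕ) :
    ∃ w, G w ∧ w.length = m * E ∧ ∀ k, ∀ f ∈ F k, ¬ f <:+: w := by
  choose! ext hinj hext using hext
  have hpos : 0 < ((avoidingWords ext F m).card : ℝ) := by
    induction m with
    | zero => simp [avoidingWords]
    | succ m ih =>
      have := card_avoidingWords_growth hE h0 hext hinj hF hsum m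
      linarith
  obtain ⟨w, hw⟩ := Finset.card_pos.1 (Nat.cast_pos.1 hpos)
  obtain ⟨h1, h2⟩ := avoidingWords_spec h0 hext hw
  exact ⟨w, h1, h2, fun k f hf => not_infix_of_mem_avoidingWords hE hF hw hf⟩

/-! ### Choice of parameters and the contradiction -/

theorem exists_sum_tail_le_half :
    ∃ K : ℕ, ∀ g : ℕ → ℝ, (∀ k < K, g k = 0) →
      (∀ k, g k ≤ 2 * ((k : ℝ) + 2) ^ 5 * (2 / 3) ^ k) →
      ∀ m, ∑ k ∈ Finset.range m, g k ≤ 1 / 2 := by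
  set f : ℕ → ℝ := fun k => 2 * ((k : ℝ) + 2) ^ 5 * (2 / 3) ^ k with hf
  have hf0 : ∀ k, 0 ≤ f k := fun k => by positivity
  have hsf : Summable f := by
    have h1 : Summable fun k : ℕ => (k : ℝ) ^ 5 * (2 / 3 : ℝ) ^ k :=
      summable_pow_mul_geometric_of_norm_lt_one 5 (by norm_num)
    have h2 := (((summable_nat_add_iff 2).2 h1).mul_left (9 / 2))
    refine h2.congr fun k => ?_
    simp only [hf]
    push_cast
    ring
  have ht := tendsto_sum_nat_add f
  obtain ⟨K, hK⟩ := (ht.eventually_lt_const (show (0 : ℝ) < 1 / 2 by norm_num)).exists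
  refine ⟨K, fun g hg0 hg m => ?_⟩
  by_cases hm : m ≤ K
  · rw [Finset.sum_eq_zero fun k hk => hg0 k (by have := Finset.mem_range.1 hk; omega)]
    norm_num
  · obtain ⟨l, rfl⟩ := Nat.exists_eq_add_of_le (by omega : K ≤ m)
    rw [Finset.sum_range_add, Finset.sum_eq_zero fun k hk => hg0 k (Finset.mem_range.1 hk), zero_add]
    calc ∑ x ∈ Finset.range l, g (K + x) ≤ ∑ x ∈ Finset.range l, f (x + K) := by
          refine Finset.sum_le_sum fun x _ => ?_
          rw [add_comm x]
          exact hg _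
      _ ≤ ∑' x, f (x + K) :=
          ((summable_nat_add_iff K).2 hsf).sum_le_tsum _ fun _ _ => hf0 _
      _ ≤ 1 / 2 := hK.le

/-- Otherwise `W` would have arbitrarily long subwords avoiding one of its subwords `v`. -/
theorem not_forall_three_pow_cogrowth_le (hα : Nat.card α = 2) {W : ℕ → α}
    (hW : IsUniformlyRecurrent W) (hper : ¬ IsPeriodic W) (n₀ : ℕ) :
    ¬ ∀ n, n₀ ≤ n → 3 ^ cogrowth W n ≤ n := by
  intro hslow
  have : Finite α := Nat.finite_of_card_ne_zero (by omega)
  obtain ⟨K, hK⟩ := exists_sum_tail_le_half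
  obtain ⟨n, N, hnN, hn₀, hKn⟩ : ∃ n N, n = N + 1 ∧ n₀ ≤ n ∧ (K + 2) ^ 3 ≤ n :=
    ⟨_, n₀ + (K + 2) ^ 3, rfl, by omega, by omega⟩
  set E := 2 ^ cogrowth W n with hE
  have hEpos : 0 < E := by positivity
  have hE3 : E ^ 3 ≤ n ^ 2 := calc
    E ^ 3 = (2 ^ 3) ^ cogrowth W n := by rw [hE, ← pow_mul, ← pow_mul, mul_comm]
    _ ≤ (3 ^ 2) ^ cogrowth W n := Nat.pow_le_pow_left (by norm_num) _
    _ = (3 ^ cogrowth W n) ^ 2 := by rw [← pow_mul, ← pow_mul, mul_comm]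
    _ ≤ n ^ 2 := Nat.pow_le_pow_left (hslow n hn₀) _
  have hgap : HasGap W N E := by
    rw [hE, hnN]
    exact hasGap_two_pow_cogrowth hα hW hper N
  have hEn : E ≤ n := (Nat.pow_le_pow_left (by norm_num : 2 ≤ 3) _).trans (hslow n hn₀)
  set v := block W 0 (n + 1) with hv
  -- Forbidden words are sorted by length in units of `E`; as `E ≤ n`, the quotient is at least 1.
  set S : ℕ → Set (List α) := fun k =>
    {f | (IsObstruction W f ∧ n < f.length ∨ f = v) ∧ f.length / E = k + 1} with hS
  have hSlen : ∀ k, ∀ f ∈ S k, n < f.length ∧ (k + 1) * E ≤ f.length ∧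
      f.length < (k + 2) * E := by
    rintro k f ⟨h1, h2⟩
    refine ⟨?_, ?_, ?_⟩
    · rcases h1 with h1 | rfl
      · exact h1.2
      · simp [hv]
    · rw [← h2]; exact Nat.div_mul_le_self _ _
    · rw [← Nat.div_lt_iff_lt_mul hEpos]; omega
  have hSsub : ∀ k, S k ⊆ insert v {u | IsObstruction W u ∧ u.length ≤ (k + 2) * E} := by
    intro k f hf
    have h := hSlen k f hf
    rcases hf.1 with h1 | rfl
    · exact Or.inr ⟨h1.1, h.2.2.le⟩
    · exact Or.inl rfl
  have hSfin : ∀ k, (S k).Finite := fun k =>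
    ((finite_obstructions W _).insert v).subset (hSsub k)
  have hScard : ∀ k, n < (k + 2) * E → (S k).ncard ≤ (k + 2) * E := by
    intro k hk
    calc (S k).ncard ≤ cogrowth W ((k + 2) * E) + 1 :=
          (Set.ncard_le_ncard (hSsub k) ((finite_obstructions W _).insert v)).trans
            (Set.ncard_insert_le _ _)
      -- The strict inequality `c < 3 ^ c` absorbs the extra word `v`.
      _ ≤ 3 ^ cogrowth W ((k + 2) * E) := Nat.lt_pow_self (by norm_num)
      _ ≤ (k + 2) * E := hslow _ (by omega)
  have hSempty : ∀ k, ¬ n < (k + 2) * E → S k = ∅ := by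
    intro k hk
    refine Set.eq_empty_of_forall_notMem fun f hf => ?_
    have := hSlen k f hf
    omega
  have hcoe : ∀ k, (hSfin k).toFinset.card = (S k).ncard := fun k =>
    (Set.ncard_eq_toFinset_card _ (hSfin k)).symm
  have hsum : ∀ m, ∑ k ∈ Finset.range m,
      (((hSfin k).toFinset.card : ℝ) * E * 2) * (2 / 3) ^ k ≤ 1 / 2 := by
    refine hK _ (fun k hk => ?_) fun k => ?_
    · rw [hcoe, hSempty k]
      · simp
      -- A nonempty class forces `n < (k + 2) ^ 3`, which the choice of `n` excludes for `k < K`.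
      · intro hlt
        have h1 : n ^ 3 < ((k + 2) * E) ^ 3 := Nat.pow_lt_pow_left hlt (by norm_num)
        have h2 : ((k + 2) * E) ^ 3 ≤ (K + 2) ^ 3 * n ^ 2 := by
          rw [mul_pow]
          exact Nat.mul_le_mul (Nat.pow_le_pow_left (by omega) 3) hE3
        have h3 : (K + 2) ^ 3 * n ^ 2 ≤ n ^ 3 := by
          rw [pow_succ' n 2]
          exact Nat.mul_le_mul_right _ hKn
        omega
    · rw [hcoe]
      by_cases hlt : n < (k + 2) * E
      · have h1 : E ≤ (k + 2) ^ 2 := by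
          have : E ^ 2 * E ≤ E ^ 2 * (k + 2) ^ 2 := calc
            E ^ 2 * E = E ^ 3 := by ring
            _ ≤ n ^ 2 := hE3
            _ ≤ ((k + 2) * E) ^ 2 := Nat.pow_le_pow_left hlt.le 2
            _ = E ^ 2 * (k + 2) ^ 2 := by ring
          exact Nat.le_of_mul_le_mul_left this (by positivity)
        have h2 : (S k).ncard * E * 2 ≤ 2 * (k + 2) ^ 5 := calc
          (S k).ncard * E * 2 ≤ (k + 2) * (k + 2) ^ 2 * (k + 2) ^ 2 * 2 := by
            gcongr
            exact (hScard k hlt).trans (Nat.mul_le_mul_left _ h1)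
          _ = 2 * (k + 2) ^ 5 := by ring
        refine mul_le_mul_of_nonneg_right ?_ (by positivity)
        exact_mod_cast h2
      · rw [hSempty k hlt]
        simp only [Set.ncard_empty, Nat.cast_zero, zero_mul]
        positivity
  obtain ⟨C, hC⟩ := hW v (isSubword_block ..)
  obtain ⟨w, hw, hlen, havoid⟩ := exists_avoiding_word (G := IsLocalSubword W (N + 1)) hEpos
    (fun u hu _ => by rw [List.infix_nil.1 hu]; exact isSubword_block W 0 0)
    (fun w hw => hw.exists_two_extensions hα hW hgap)
    (F := fun k => (hSfin k).toFinset)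
    (fun k f hf => (hSlen k f ((hSfin k).mem_toFinset.1 hf)).2.1) hsum C
  have havoid' : ∀ f, (IsObstruction W f ∧ n < f.length ∨ f = v) → ¬ f <:+: w := by
    intro f hf
    have hn : n < f.length := by
      rcases hf with hf | rfl
      · exact hf.2
      · simp [hv]
    have hdiv : 1 ≤ f.length / E := (Nat.one_le_div_iff hEpos).2 (by omega)
    exact havoid (f.length / E - 1) f ((hSfin _).mem_toFinset.2 ⟨hf, by omega⟩)
  have hwW : IsSubword W w := by
    refine isSubword_of_forall_not_isObstruction fun u hu hob => ?_
    by_cases hl : u.length ≤ N + 1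
    · exact hob.1 (hw u hu hl)
    · exact havoid' u (Or.inl ⟨hob, by omega⟩) hu
  have hCle : C ≤ w.length := by
    rw [hlen]
    exact Nat.le_mul_of_pos_right _ hEpos
  refine havoid' v (Or.inr rfl) ((hC (w.take C) ?_ (by simp [hCle])).trans
    (List.take_prefix C w).isInfix)
  exact hwW.of_infix (List.take_prefix C w).isInfix

end Cogrowth

theorem mainTheorem3 {α : Type*} (hα : Nat.card α = 2) (W : ℕ → α)
    (hrec : Cogrowth.IsUniformlyRecurrent W) (hper : ¬ Cogrowth.IsPeriodic W) :
    (1 : EReal) ≤ Filter.limsup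
      (fun n : ℕ => (((Cogrowth.cogrowth W n : ℝ) / Real.logb 3 (n : ℝ) : ℝ) : EReal))
      Filter.atTop := by
  by_contra! hlt
  obtain ⟨n₀, hn₀⟩ := Filter.eventually_atTop.1 (Filter.eventually_lt_of_limsup_lt hlt)
  refine Cogrowth.not_forall_three_pow_cogrowth_le hα hrec hper (n₀ + 2) fun n hn => ?_
  have h1 : (Cogrowth.cogrowth W n : ℝ) / Real.logb 3 n < 1 := by
    exact_mod_cast hn₀ n (by omega)
  have hn1 : (1 : ℝ) < n := by exact_mod_cast (by omega : 1 < n)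
  rw [div_lt_one (Real.logb_pos (by norm_num) hn1),
    Real.lt_logb_iff_rpow_lt (by norm_num) (by linarith), Real.rpow_natCast] at h1
  exact_mod_cast h1.le
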